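/- **Setting.** A game has $N$ players, $1\le n<N$; players in $\mathbb N_f=\{1,\dots,n\}$ are first-order, $\dot x_i=u_i+g_i(\mathbf x)+d_i(t)$, and players in $\mathbb N_s=\{n+1,\dots,N\}$ are second-order, $\dot x_i=v_i$, $\dot v_i=u_i+g_i(\mathbf x)+d_i(t)$, with $x_i,v_i,u_i\in\mathbb R$. Player $i$ has cost $f_i:\mathbb R^N\to\mathbb R$; write $\nabla_if_i=\partial f_i/\partial x_i$. Let $\mathbf x^*$ be a Nash equilibrium: $f_i(\mathbf x^*)\le f_i(x_i,\mathbf x^*_{-i})$ for all $i$ and all $x_i\in\mathbb R$. Assume: 1. each $f_i$ is $C^2$ and $\nabla_if_i$ is globally Lipschitz; 2. the communication graph, with adjacency matrix $[a_{ij}]$, $a_{ij}\in\{0,1\}$, $a_{ii}=0$, is undirected and connected; 3. for some $m>0$, $(\mathbf x-\mathbf z)^T(\mathcal P(\mathbf x)-\mathcal P(\mathbf z))\ge m\|\mathbf x-\mathbf z\|^2$ for all $\mathbf x,\mathbf z\in\mathbb R^N$, where $\mathcal P=[\nabla_1f_1,\dots,\nabla_Nf_N]^T$; 4. $\partial^2f_i/\partial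 x_i\partial x_j$ is bounded for $i\in\mathbb N_s$ and all $j$; 5. each $g_i:\mathbb R^N\to\mathbb R$ is globally Lipschitz and each $d_i$ is bounded on $[0,\infty)$. **Controller.** Fix $\delta,\epsilon,W_{\max}>0$ and let $\mathcal K$ be the real number with $\mathcal K=e^{-(\mathcal K+1)}$. The gains are $\beta,k_1,k_2,k_3,k_4>0$. Player $i$ has a Gaussian radial basis function network $S_i:\mathbb R^N\to\mathbb R^{q_i}$, $S_i(\xi)_k=\exp(-\|\xi-\mu_{ik}\|^2/\rho_{ik}^2)$ with $\rho_{ik}>0$, an adaptive weight $\hat W_i\in\mathbb R^{q_i}$, and an estimate $\mathbf y_i=[y_{i1},\dots,y_{iN}]^T$; first-order players also have $z_i\in\mathbb R$. Put $\bar x_j=z_j$ for $j\in\mathbb N_f$ and $\bar x_j=x_j$ for $j\in\mathbb N_s$; put $s_i=x_i-z_i$ for $i\in\mathbb N_f$ and $s_i=k_2\nabla_if_i(\mathbf y_i)+v_i$ for $i\in\mathbb N_s$; and $\phi_i=\delta\tanh(\mathcal K\delta s_i/\epsilon)$. The controls are $$u_i=-k_1(x_i-z_i)-\hat W_i^TS_i(\mathbf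 y_i)-\phi_i\ (i\in\mathbb N_f),\qquad u_i=-k_2k_4\nabla_if_i(\mathbf y_i)-k_4v_i-\hat W_i^TS_i(\mathbf y_i)-\phi_i\ (i\in\mathbb N_s),$$ with $\dot z_i=-k_2\nabla_if_i(\mathbf y_i)$ for $i\in\mathbb N_f$, with $$\dot y_{ij}=-k_3\Big(\sum_{k=1}^Na_{ik}(y_{ij}-y_{kj})+a_{ij}(y_{ij}-\bar x_j)\Big)\quad\text{for all } i,j,$$ and with the projected adaptive law $$\dot{\hat W}_i=\beta s_iS_i(\mathbf y_i)\quad\text{if }\hat W_i^T\hat W_i<W_{\max},\text{ or if }\hat W_i^T\hat W_i=W_{\max}\text{ and }s_i\hat W_i^TS_i(\mathbf y_i)<0,$$ $$\dot{\hat W}_i=\beta s_iS_i(\mathbf y_i)-\beta\frac{s_i\hat W_i^TS_i(\mathbf y_i)}{\hat W_i^T\hat W_i}\hat W_i\quad\text{if }\hat W_i^T\hat W_i=W_{\max}\text{ and }s_i\hat W_i^TS_i(\mathbf y_i)\ge0,$$ with $\hat W_i(0)^T\hat W_i(0)\le W_{\max}$. Trajectories are Carathéodory solutions on $[0,\infty)$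 (locally absolutely continuous, equations satisfied almost everywhere). **Theorem.** For all $\Lambda,\Xi>0$ there exist $\beta^*,k_2^*>0$ such that for all $\beta>\beta^*$ and $k_2>k_2^*$ there exist $k_1^*(k_2),k_3^*(k_2)>0$ such that for all $k_1>k_1^*(k_2)$ and $k_3>k_3^*(k_2)$ there exists $k_4^*(k_2,k_3)>0$ such that for every $k_4>k_4^*(k_2,k_3)$ there is $T\ge0$ with the following property. Consider any networks $S_i$, any weights $W_i^*\in\mathbb R^{q_i}$ with $W_i^{*T}W_i^*\le W_{\max}$, and any closed-loop trajectory along which $\varepsilon_i:=g_i(\mathbf y_i)-W_i^{*T}S_i(\mathbf y_i)$ satisfies $|\varepsilon_i|+|d_i(t)|\le\delta$ for all $i$ and all $t\ge0$. If, with $\tilde W_i=\hat W_i-W_i^*$, $\mathbf x_f=[x_i]_{i\in\mathbb N_f}$, $\mathbf z_f=[z_i]_{i\in\mathbb N_f}$, $\mathbf v_s=[v_i]_{i\in\mathbb N_s}$, $\mathbf y=[\mathbf y_1^T,\dots,\mathbf y_N^T]^T$, $\bar{\mathbf x}=[\bar x_1,\dots,\bar x_N]^T$, $$\big\|[(\bar{\mathbf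 x}(0)-\mathbf x^*)^T,\ \mathbf v_s(0)^T,\ (\mathbf y(0)-\mathbf 1_N\otimes\bar{\mathbf x}(0))^T,\ (\mathbf x_f(0)-\mathbf z_f(0))^T]^T\big\|+\sum_{i=1}^N\tilde W_i(0)^T\tilde W_i(0)\le\Lambda,$$ then $\|\mathbf x(t)-\mathbf x^*\|\le\Xi$ for all $t>T$. (Here $k_1^*,k_3^*$ depend on the gains only through $k_2$, and $k_4^*$ only through $k_2,k_3$.) -/

import Mathlib

open MeasureTheory Filter Topology
open scoped NNReal

noncomputable section

namespace MixedOrderGame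

/-- The players: `Sum.inl` are the `n` first-order ones, `Sum.inr` the `m` second-order ones
(so the total number of players is `n + m`). -/
abbrev Player (n m : ℕ) : Type := Fin n ⊕ Fin m

/-- Action profiles, with the Euclidean norm. -/
abbrev Profile (n m : ℕ) : Type := EuclideanSpace ℝ (Player n m)

variable {n m : ℕ}

/-- The partial derivative `∂h/∂xᵢ`. -/
def partialDeriv (i : Player n m) (h : Profile n m → ℝ) (x : Profile n m) : ℝ :=
  fderiv ℝ h x (EuclideanSpace.single i 1)

/-- Player `i`'s partial gradient `∇ᵢ fᵢ`. -/
def grad (f : Player n m → Profile n m → ℝ) (i : Player n m) (x : Profile n m) : ℝ :=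
  partialDeriv i (f i) x

/-- The pseudo-gradient `𝒫(x) = [∇₁f₁(x), …, ∇_N f_N(x)]`. -/
def pseudoGrad (f : Player n m → Profile n m → ℝ) (x : Profile n m) : Profile n m :=
  WithLp.toLp 2 (fun i => grad f i x)

/-- `xs` is a Nash equilibrium of the game with cost functions `f`. -/
def IsNashEquilibrium (f : Player n m → Profile n m → ℝ) (xs : Profile n m) : Prop :=
  ∀ (i : Player n m) (a : ℝ), f i xs ≤ f i (WithLp.toLp 2 (Function.update xs.ofLp i a))

/-- A Gaussian radial basis function network for every player: numbers of neurons, centers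
and (positive) widths. -/
structure RBFNetwork (n m : ℕ) where
  q : Player n m → ℕ
  center : (i : Player n m) → Fin (q i) → Profile n m
  width : (i : Player n m) → Fin (q i) → ℝ
  width_pos : ∀ i k, 0 < width i k

/-- The activation vector `Sᵢ(ξ)`. -/
def RBFNetwork.S (net : RBFNetwork n m) (i : Player n m) (ξ : Profile n m) :
    EuclideanSpace ℝ (Fin (net.q i)) :=
  WithLp.toLp 2 (fun k => Real.exp (-(‖ξ - net.center i k‖ ^ 2) / (net.width i k) ^ 2))

/-- Weight vectors `(Wᵢ)ᵢ`. -/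
abbrev RBFNetwork.Weights (net : RBFNetwork n m) : Type :=
  (i : Player n m) → EuclideanSpace ℝ (Fin (net.q i))

/-- The approximation error `εᵢ(ξ) = gᵢ(ξ) - Wᵢᵀ Sᵢ(ξ)` of the weights `W`. -/
def RBFNetwork.approxError (net : RBFNetwork n m) (g : Player n m → Profile n m → ℝ)
    (W : net.Weights) (i : Player n m) (ξ : Profile n m) : ℝ :=
  g i ξ - inner ℝ (W i) (net.S i ξ)

/-- The gains of the algorithm. -/
structure Gains where
  k₁ : ℝ
  k₂ : ℝ
  k₃ : ℝ
  k₄ : ℝ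
  β : ℝ

/-- The remaining parameters of the controller: the amplitude `δ` of the robust term, its
smoothing parameter `ε`, the bound `Wmax` in the projection, and the number `κ`
in the argument of `tanh`. -/
structure RobustParams where
  δ : ℝ
  ε : ℝ
  Wmax : ℝ
  κ : ℝ

/-- The state variables as functions of time: actions `x`, auxiliary variables `z` of the
first-order players, velocities `v` of the second-order players, player `i`'s estimate `y i`
of the action profile, and the adaptive weights `W i`. Only times `t ≥ 0` matter. -/
structure Traj (net : RBFNetwork n m) where
  x : ℝ → Profile n m
  z : ℝ → EuclideanSpace ℝ (Fin n)
  v : ℝ → EuclideanSpace ℝ (Fin m)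
  y : Player n m → ℝ → Profile n m
  W : (i : Player n m) → ℝ → EuclideanSpace ℝ (Fin (net.q i))

variable {net : RBFNetwork n m}

/-- `x̄`, with `x̄ⱼ = zⱼ` for first-order players and `x̄ⱼ = xⱼ` for second-order players. -/
def Traj.xbar (τ : Traj net) (t : ℝ) : Profile n m :=
  WithLp.toLp 2 (Sum.elim (fun j => τ.z t j) (fun j => τ.x t (Sum.inr j)))

/-- The scalar signal that drives the adaptive law and the robust term of each player:
`xᵢ - zᵢ` for first-order players, `k₂ ∇ᵢfᵢ(yᵢ) + vᵢ` for second-order players. -/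
def Traj.signal (τ : Traj net) (f : Player n m → Profile n m → ℝ) (K : Gains) :
    Player n m → ℝ → ℝ
  | Sum.inl i, t => τ.x t (Sum.inl i) - τ.z t i
  | Sum.inr i, t => K.k₂ * grad f (Sum.inr i) (τ.y (Sum.inr i) t) + τ.v t i

/-- The robust term `φᵢ = δ tanh(κ δ s / ε)`, with `s` the signal above. -/
def robustTerm (R : RobustParams) (s : ℝ) : ℝ :=
  R.δ * Real.tanh (R.κ * R.δ * s / R.ε)

open Classical in
/-- The adaptive law with projection, `Ŵ' = adaptLaw …`, for the weight vector `W`, the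
activation vector `S` and the signal `s`. (The set `‖W‖² ≤ Wmax` is never left from inside,
so the value of the right-hand side for `‖W‖² > Wmax` is immaterial.) -/
def adaptLaw {q : ℕ} (β Wmax : ℝ) (W S : EuclideanSpace ℝ (Fin q)) (s : ℝ) :
    EuclideanSpace ℝ (Fin q) :=
  if ‖W‖ ^ 2 < Wmax ∨ (‖W‖ ^ 2 = Wmax ∧ s * inner ℝ W S < 0) then
    (β * s) • S
  else
    (β * s) • S - (β * (s * inner ℝ W S / ‖W‖ ^ 2)) • W

/-- The control input of each player. -/
def controlInput (f : Player n m → Profile n m → ℝ) (K : Gains) (R : RobustParams)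
    (τ : Traj net) : Player n m → ℝ → ℝ
  | Sum.inl i, t =>
      -K.k₁ * (τ.x t (Sum.inl i) - τ.z t i)
        - inner ℝ (τ.W (Sum.inl i) t) (net.S (Sum.inl i) (τ.y (Sum.inl i) t))
        - robustTerm R (τ.signal f K (Sum.inl i) t)
  | Sum.inr i, t =>
      -K.k₂ * K.k₄ * grad f (Sum.inr i) (τ.y (Sum.inr i) t) - K.k₄ * τ.v t i
        - inner ℝ (τ.W (Sum.inr i) t) (net.S (Sum.inr i) (τ.y (Sum.inr i) t))
        - robustTerm R (τ.signal f K (Sum.inr i) t)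

/-- `u` is a Carathéodory solution of `u'(t) = F(t)`, `t ≥ 0`: locally absolutely continuous
on `[0, ∞)`, and the equation holds at almost every `t > 0`. (The adaptive law is discontinuous
and the disturbances need not be continuous.) -/
def SolvesAE {E : Type*} [NormedAddCommGroup E] [NormedSpace ℝ E] (u F : ℝ → E) : Prop :=
  (∀ T : ℝ, 0 ≤ T → AbsolutelyContinuousOnInterval u 0 T) ∧
    ∀ᵐ t : ℝ, 0 < t → HasDerivAt u (F t) t

open Classical in
/-- `τ` is a trajectory of the closed loop: the players' first- and second-order dynamics with
unknown dynamics `g` and disturbances `d`, under the seeking strategy on the graph `G`. -/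
structure IsClosedLoop (f g : Player n m → Profile n m → ℝ) (d : Player n m → ℝ → ℝ)
    (G : SimpleGraph (Player n m)) (R : RobustParams) (K : Gains) (τ : Traj net) : Prop where
  first_action : ∀ i : Fin n, SolvesAE (fun t => τ.x t (Sum.inl i))
    (fun t => controlInput f K R τ (Sum.inl i) t + g (Sum.inl i) (τ.x t) + d (Sum.inl i) t)
  second_action : ∀ i : Fin m, SolvesAE (fun t => τ.x t (Sum.inr i)) (fun t => τ.v t i)
  second_velocity : ∀ i : Fin m, SolvesAE (fun t => τ.v t i)
    (fun t => controlInput f K R τ (Sum.inr i) t + g (Sum.inr i) (τ.x t) + d (Sum.inr i) t)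
  auxiliary : ∀ i : Fin n, SolvesAE (fun t => τ.z t i)
    (fun t => -K.k₂ * grad f (Sum.inl i) (τ.y (Sum.inl i) t))
  estimate : ∀ i j : Player n m, SolvesAE (fun t => τ.y i t j)
    (fun t => -K.k₃ * ((∑ k, G.adjMatrix ℝ i k * (τ.y i t j - τ.y k t j))
      + G.adjMatrix ℝ i j * (τ.y i t j - τ.xbar t j)))
  weights : ∀ i : Player n m, SolvesAE (τ.W i)
    (fun t => adaptLaw K.β R.Wmax (τ.W i t) (net.S i (τ.y i t)) (τ.signal f K i t))
  weights_init : ∀ i : Player n m, ‖τ.W i 0‖ ^ 2 ≤ R.Wmax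

/-- The norm of the stacked initial error
`[x̄(0) - x*, v_s(0), y(0) - 1 ⊗ x̄(0), x_f(0) - z_f(0)]`. -/
def Traj.initialErrorNorm (τ : Traj net) (xs : Profile n m) : ℝ :=
  Real.sqrt (‖τ.xbar 0 - xs‖ ^ 2 + ‖τ.v 0‖ ^ 2 + ∑ i, ‖τ.y i 0 - τ.xbar 0‖ ^ 2
    + ∑ i : Fin n, (τ.x 0 (Sum.inl i) - τ.z 0 i) ^ 2)

/-- The total initial weight error `∑ᵢ W̃ᵢ(0)ᵀ W̃ᵢ(0)`, with `W̃ᵢ = Ŵᵢ - Wᵢ*`. -/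
def Traj.initialWeightError (τ : Traj net) (Ws : net.Weights) : ℝ :=
  ∑ i, ‖τ.W i 0 - Ws i‖ ^ 2

end MixedOrderGame

end

namespace MixedOrderGame

/-! ### Calculus of Carathéodory solutions and Grönwall's inequality -/

section Calculus

variable {E : Type*} [NormedAddCommGroup E] [NormedSpace ℝ E]

/-! The proof is a Lyapunov argument with `V = ½(‖x̄ - x*‖² + ‖y - 1 ⊗ x̄‖² + Σ sᵢ² + β⁻¹ Σ
‖W̃ᵢ‖²)`. Since `vᵢ = sᵢ - k₂ ∇ᵢfᵢ(yᵢ)` for second-order players, `x̄` follows gradient play in both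
classes, up to errors in `y` and `s`, and strong monotonicity makes it contract at rate `k₂ μ`.
Connectedness makes the consensus form positive definite, so the estimates contract at a rate
proportional to `k₃`; the signals are damped by `k₁` and `k₄`.

In `s ṡ` the network error `s W̃ᵀS` is cancelled by the adaptive law (`inner_sub_adaptLaw_le`: the
projection only helps), and the approximation error plus disturbance, at most `δ`, is absorbed by
the tanh term up to `ε` (`abs_mul_sub_robustTerm_le`). The remaining cross terms are dominated by
choosing the gains in the order `k₂`, then `k₁` and `k₃`, then `k₄` (`dissipation_le`); `k₄` comes
last because `ṡ` of a second-order player contains `k₂ k₃`.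

The weight error is not dissipated, but projection keeps it bounded, so its share of `V` is
`O(1/β)`. Altogether `V' ≤ -2ρV + c`, and `c / (2ρ)` is small when `ρ` and `β` are large. Grönwall
concludes, uniformly over trajectories because `V(0)` is bounded through `Λ` and the gains. -/

theorem _root_.LipschitzWith.comp_absolutelyContinuousOnInterval {X Y : Type*}
    [PseudoMetricSpace X] [PseudoMetricSpace Y] {h : X → Y} {K : ℝ≥0} (hh : LipschitzWith K h)
    {u : ℝ → X} {a b : ℝ} (hu : AbsolutelyContinuousOnInterval u a b) :
    AbsolutelyContinuousOnInterval (fun t => h (u t)) a b := by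
  apply squeeze_zero (fun t ↦ ?_) (fun t ↦ ?_) (by simpa using Tendsto.const_mul (K : ℝ) hu)
  · exact Finset.sum_nonneg (fun i hi ↦ by positivity)
  · rw [Finset.mul_sum]
    exact Finset.sum_le_sum fun i _ => hh.dist_le_mul _ _

theorem SolvesAE.add {u v F H : ℝ → E} (hu : SolvesAE u F) (hv : SolvesAE v H) :
    SolvesAE (fun t => u t + v t) (fun t => F t + H t) := by
  refine ⟨fun T hT => (hu.1 T hT).fun_add (hv.1 T hT), ?_⟩
  filter_upwards [hu.2, hv.2] with t h1 h2 ht using (h1 ht).fun_add (h2 ht)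

theorem SolvesAE.sub {u v F H : ℝ → E} (hu : SolvesAE u F) (hv : SolvesAE v H) :
    SolvesAE (fun t => u t - v t) (fun t => F t - H t) := by
  refine ⟨fun T hT => (hu.1 T hT).fun_sub (hv.1 T hT), ?_⟩
  filter_upwards [hu.2, hv.2] with t h1 h2 ht using (h1 ht).fun_sub (h2 ht)

theorem SolvesAE.congr_rate {u F H : ℝ → E} (hu : SolvesAE u F) (h : ∀ t, F t = H t) :
    SolvesAE u H :=
  (funext h : F = H) ▸ hu

theorem SolvesAE.of_contDiff {u u' : ℝ → E} (hu : ContDiff ℝ 1 u)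
    (hu' : ∀ t, HasDerivAt u (u' t) t) : SolvesAE u u' :=
  ⟨fun _ _ => hu.contDiffOn.absolutelyContinuousOnInterval,
    Eventually.of_forall fun t _ => hu' t⟩

theorem SolvesAE.const (c : E) : SolvesAE (fun _ => c) (fun _ => 0) :=
  .of_contDiff contDiff_const fun t => hasDerivAt_const t c

theorem SolvesAE.sum {ι : Type*} (s : Finset ι) {u F : ι → ℝ → E}
    (h : ∀ i ∈ s, SolvesAE (u i) (F i)) :
    SolvesAE (fun t => ∑ i ∈ s, u i t) (fun t => ∑ i ∈ s, F i t) := by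
  classical
  induction s using Finset.induction_on with
  | empty => simpa using SolvesAE.const (0 : E)
  | insert a s ha ih =>
    simp only [Finset.sum_insert ha]
    exact (h a (by simp)).add (ih fun i hi => h i (by simp [hi]))

theorem SolvesAE.smul {c c' : ℝ → ℝ} {u F : ℝ → E} (hc : SolvesAE c c') (hu : SolvesAE u F) :
    SolvesAE (fun t => c t • u t) (fun t => c t • F t + c' t • u t) := by
  refine ⟨fun T hT => (hc.1 T hT).fun_smul (hu.1 T hT), ?_⟩
  filter_upwards [hc.2, hu.2] with t h1 h2 ht using (h1 ht).fun_smul (h2 ht)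

theorem SolvesAE.const_smul (c : ℝ) {u F : ℝ → E} (hu : SolvesAE u F) :
    SolvesAE (fun t => c • u t) (fun t => c • F t) := by
  simpa using (SolvesAE.const c).smul hu

/-- The Lipschitz bound preserves absolute continuity; differentiability gives the chain rule
wherever `u` is differentiable. -/
theorem SolvesAE.comp_lipschitz {u F : ℝ → E} (hu : SolvesAE u F) {h : E → ℝ} {K : ℝ≥0}
    (hh : LipschitzWith K h) (hd : Differentiable ℝ h) :
    SolvesAE (fun t => h (u t)) (fun t => fderiv ℝ h (u t) (F t)) := by
  refine ⟨fun T hT => hh.comp_absolutelyContinuousOnInterval (hu.1 T hT), ?_⟩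
  filter_upwards [hu.2] with t h1 ht
  exact (hd (u t)).hasFDerivAt.comp_hasDerivAt t (h1 ht)

theorem SolvesAE.sq {u F : ℝ → ℝ} (hu : SolvesAE u F) :
    SolvesAE (fun t => u t ^ 2) (fun t => 2 * (u t * F t)) := by
  convert hu.smul hu using 2 with t t
  · simp [pow_two]
  · simp; ring

theorem SolvesAE.norm_sq {E : Type*} [NormedAddCommGroup E] [InnerProductSpace ℝ E]
    {u F : ℝ → E} (hu : SolvesAE u F) :
    SolvesAE (fun t => ‖u t‖ ^ 2) (fun t => 2 * inner ℝ (u t) (F t)) := by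
  constructor
  · intro T hT
    have h := lipschitzWith_one_norm.comp_absolutelyContinuousOnInterval (hu.1 T hT)
    simpa only [pow_two] using h.fun_mul h
  · filter_upwards [hu.2] with t h ht
    exact (h ht).norm_sq

theorem SolvesAE.of_coords {ι : Type*} [Fintype ι] {u F : ℝ → EuclideanSpace ℝ ι}
    (h : ∀ j, SolvesAE (fun t => u t j) (fun t => F t j)) : SolvesAE u F := by
  classical
  have := SolvesAE.sum Finset.univ fun j _ =>
    (h j).smul (SolvesAE.const (EuclideanSpace.single j (1 : ℝ)))
  convert this using 2 with t t
  · ext k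
    simp [Finset.sum_apply, Pi.single_apply]
  · ext k
    simp [Finset.sum_apply, Pi.single_apply]

/-- The fundamental theorem of calculus for absolutely continuous functions: the increment is the
integral of an a.e. nonpositive derivative. -/
theorem le_of_absolutelyContinuous {u : ℝ → ℝ} {F : ℝ → ℝ} {a b : ℝ} (hab : a ≤ b)
    (hu : AbsolutelyContinuousOnInterval u a b)
    (h : ∀ᵐ t, t ∈ Set.Ioo a b → HasDerivAt u (F t) t ∧ F t ≤ 0) : u b ≤ u a := by
  have h1 := hu.integral_deriv_eq_sub
  have h2 : ∫ t in a..b, deriv u t ≤ 0 := by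
    rw [intervalIntegral.integral_of_le hab, integral_Ioc_eq_integral_Ioo]
    refine integral_nonpos_of_ae ((ae_restrict_iff' measurableSet_Ioo).2 ?_)
    filter_upwards [h] with t ht hmem
    rw [(ht hmem).1.deriv]
    exact (ht hmem).2
  linarith

theorem SolvesAE.le {u F : ℝ → ℝ} (hu : SolvesAE u F) {a b : ℝ} (ha : 0 ≤ a) (hab : a ≤ b)
    (h : ∀ᵐ t, t ∈ Set.Ioo a b → F t ≤ 0) : u b ≤ u a := by
  refine le_of_absolutelyContinuous hab ((hu.1 b (ha.trans hab)).mono ?_) (F := F) ?_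
  · rw [Set.uIcc_of_le hab, Set.uIcc_of_le (ha.trans hab)]
    exact Set.Icc_subset_Icc_left ha
  · filter_upwards [hu.2, h] with t h1 h2 ht using ⟨h1 (ha.trans_lt ht.1), h2 ht⟩

/-- Grönwall's inequality for Carathéodory solutions. -/
theorem SolvesAE.le_exp {V F : ℝ → ℝ} (hV : SolvesAE V F) {r c : ℝ} (hr : 0 < r)
    (h : ∀ᵐ t, 0 < t → F t ≤ -r * V t + c) {t : ℝ} (ht : 0 ≤ t) :
    V t ≤ Real.exp (-r * t) * (V 0 - c / r) + c / r := by
  have hexp : SolvesAE (fun t => Real.exp (r * t)) (fun t => Real.exp (r * t) * r) :=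
    .of_contDiff (by fun_prop) fun t => by
      simpa using ((hasDerivAt_id t).const_mul r).exp
  -- Integrating factor: `exp(rt) (V - c/r)` is nonincreasing.
  have key := (hexp.smul (hV.sub (SolvesAE.const (c / r)))).le le_rfl ht <| by
    filter_upwards [h] with s hs hmem
    have h1 := hs hmem.1
    simp only [smul_eq_mul]
    have h2 : F s - 0 + r * (V s - c / r) ≤ 0 := by
      have : r * (c / r) = c := by field_simp
      linarith
    nlinarith [Real.exp_pos (r * s)]
  simp only [smul_eq_mul, mul_zero, Real.exp_zero, one_mul] at key
  have h3 : Real.exp (-r * t) * Real.exp (r * t) = 1 := by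
    rw [← Real.exp_add]; simp
  have h4 := mul_le_mul_of_nonneg_left key (Real.exp_pos (-r * t)).le
  rw [← mul_assoc, h3] at h4
  linarith

end Calculus
end MixedOrderGame
namespace MixedOrderGame

variable {n m : ℕ}

/-! ### The adaptive law -/

theorem inner_adaptLaw_self_of_lt {q : ℕ} {β Wmax s : ℝ} {W S : EuclideanSpace ℝ (Fin q)}
    (hWmax : 0 < Wmax) (hW : Wmax < ‖W‖ ^ 2) : inner ℝ W (adaptLaw β Wmax W S s) = 0 := by
  have h0 : ‖W‖ ≠ 0 := fun h => by simp [h] at hW; linarith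
  rw [adaptLaw, if_neg (by rintro (h | ⟨h, -⟩) <;> linarith), inner_sub_right, inner_smul_right,
    inner_smul_right, real_inner_self_eq_norm_sq]
  field_simp
  ring

/-- If the bound failed at `t`, take the last earlier time `a` at which it held. On `(a, t)` the
projected branch is active and has no radial component, so the norm could not have grown. -/
theorem norm_sq_le_of_adaptLaw {q : ℕ} {β Wmax : ℝ} (hWmax : 0 < Wmax)
    {w S : ℝ → EuclideanSpace ℝ (Fin q)} {s : ℝ → ℝ}
    (hw : SolvesAE w fun t => adaptLaw β Wmax (w t) (S t) (s t)) (h0 : ‖w 0‖ ^ 2 ≤ Wmax)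
    {t : ℝ} (ht : 0 ≤ t) : ‖w t‖ ^ 2 ≤ Wmax := by
  by_contra! hlt
  have hcont : ContinuousOn (fun r => ‖w r‖ ^ 2) (Set.Icc 0 t) := by
    have := (hw.norm_sq.1 t ht).continuousOn
    rwa [Set.uIcc_of_le ht] at this
  have hcomp : IsCompact (Set.Icc 0 t ∩ (fun r => ‖w r‖ ^ 2) ⁻¹' Set.Iic Wmax) :=
    isCompact_Icc.of_isClosed_subset (hcont.preimage_isClosed_of_isClosed isClosed_Icc isClosed_Iic)
      Set.inter_subset_left
  obtain ⟨a, ⟨⟨ha0, hat⟩, ha⟩, hmax⟩ := hcomp.exists_isGreatest ⟨0, ⟨le_rfl, ht⟩, h0⟩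
  have := hw.norm_sq.le ha0 hat <| Eventually.of_forall fun r hr => by
    have hr' : Wmax < ‖w r‖ ^ 2 := by
      by_contra! hle
      exact hr.1.not_ge (hmax ⟨⟨ha0.trans hr.1.le, hr.2.le⟩, hle⟩)
    rw [inner_adaptLaw_self_of_lt hWmax hr', mul_zero]
  have ha' : ‖w a‖ ^ 2 ≤ Wmax := ha
  linarith

/-- On the sphere `‖Ws‖ ≤ ‖W‖`, so `⟨W - Ws, W⟩ ≥ 0` and the correction subtracted by the projection
has a favourable sign. -/
theorem inner_sub_adaptLaw_le {q : ℕ} {β Wmax s : ℝ} {W Ws S : EuclideanSpace ℝ (Fin q)}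
    (hβ : 0 ≤ β) (hW : ‖W‖ ^ 2 ≤ Wmax) (hWs : ‖Ws‖ ^ 2 ≤ Wmax) :
    inner ℝ (W - Ws) (adaptLaw β Wmax W S s) ≤ β * (s * inner ℝ (W - Ws) S) := by
  rw [adaptLaw]
  split_ifs with h
  · rw [inner_smul_right, mul_assoc]
  · push Not at h
    have hWeq : ‖W‖ ^ 2 = Wmax := le_antisymm hW h.1
    have hs := h.2 hWeq
    have hinner : 0 ≤ inner ℝ (W - Ws) W := by
      rw [inner_sub_left, real_inner_self_eq_norm_sq]
      have h1 := real_inner_le_norm Ws W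
      nlinarith [sq_nonneg (‖Ws‖ - ‖W‖)]
    rw [inner_sub_right, inner_smul_right, inner_smul_right, mul_assoc]
    have : 0 ≤ β * (s * inner ℝ W S / ‖W‖ ^ 2) * inner ℝ (W - Ws) W := by positivity
    linarith

/-! ### The robust term -/

/-- As `1 - tanh w = 2 / (exp(2w) + 1)`, the claim is `2w ≤ κ exp(2w) + κ`. The equation for `κ`
turns `κ exp(2w)` into `exp(2w - κ - 1)`, and `1 + u ≤ exp u` finishes. -/
theorem mul_one_sub_tanh_le {κ w : ℝ} (hκ : κ = Real.exp (-(κ + 1))) :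
    w * (1 - Real.tanh w) ≤ κ := by
  have h1 : 1 - Real.tanh w = 2 / (Real.exp (2 * w) + 1) := by
    rw [Real.tanh_eq_sinh_div_cosh, Real.sinh_eq, Real.cosh_eq]
    have h2 : Real.exp (2 * w) = Real.exp w * Real.exp w := by rw [← Real.exp_add]; ring_nf
    have h3 : Real.exp w * Real.exp (-w) = 1 := by rw [← Real.exp_add]; simp
    have := Real.exp_pos w
    have := Real.exp_pos (-w)
    rw [h2]
    field_simp
    linear_combination 2 * Real.exp w * h3
  have h4 : κ * Real.exp (2 * w) ≥ 2 * w - κ := by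
    have h5 : κ * Real.exp (2 * w) = Real.exp (2 * w - κ - 1) := by
      nth_rw 1 [hκ]
      rw [← Real.exp_add]; ring_nf
    have := Real.add_one_le_exp (2 * w - κ - 1)
    linarith
  have := Real.exp_pos (2 * w)
  rw [h1, ← mul_div_assoc, div_le_iff₀ (by positivity)]
  linarith

theorem abs_mul_sub_robustTerm_le {R : RobustParams} (hδ : 0 < R.δ) (hε : 0 < R.ε)
    (hκ : R.κ = Real.exp (-(R.κ + 1))) (s : ℝ) :
    |s| * R.δ - s * robustTerm R s ≤ R.ε := by
  have hκ0 : 0 < R.κ := hκ ▸ Real.exp_pos _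
  have hodd : s * robustTerm R s = |s| * robustTerm R |s| := by
    rcases abs_cases s with ⟨h, _⟩ | ⟨h, _⟩ <;> rw [h]
    simp only [robustTerm]
    rw [show R.κ * R.δ * -s / R.ε = -(R.κ * R.δ * s / R.ε) by ring, Real.tanh_neg]
    ring
  rw [hodd, robustTerm]
  have h := mul_one_sub_tanh_le (w := R.κ * R.δ * |s| / R.ε) hκ
  have h2 := mul_le_mul_of_nonneg_left h (div_pos hε hκ0).le
  have h3 : R.ε / R.κ * R.κ = R.ε := by field_simp
  rw [h3] at h2
  refine le_trans (le_of_eq ?_) h2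
  field_simp

/-! ### The game -/

theorem contDiff_grad {f : Player n m → Profile n m → ℝ} {i : Player n m}
    (hf : ContDiff ℝ 2 (f i)) : ContDiff ℝ 1 (grad f i) :=
  (hf.fderiv_right (m := 1) (by norm_num)).clm_apply contDiff_const

theorem IsNashEquilibrium.grad_eq_zero {f : Player n m → Profile n m → ℝ} {xs : Profile n m}
    (hxs : IsNashEquilibrium f xs) {i : Player n m} (hf : DifferentiableAt ℝ (f i) xs) :
    grad f i xs = 0 := by
  have hline : ∀ a : ℝ, (WithLp.toLp 2 (Function.update xs.ofLp i (xs i + a)) : Profile n m)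
      = xs + a • EuclideanSpace.single i (1 : ℝ) := by
    intro a
    ext j
    by_cases h : j = i
    · subst h; simp
    · simp [h]
  have hd : HasDerivAt (fun a : ℝ => f i (xs + a • EuclideanSpace.single i (1 : ℝ)))
      (grad f i xs) 0 := by
    have h1 : HasDerivAt (fun a : ℝ => xs + a • EuclideanSpace.single i (1 : ℝ))
        (EuclideanSpace.single i (1 : ℝ)) 0 := by
      simpa using ((hasDerivAt_id (0 : ℝ)).smul_const
        (EuclideanSpace.single i (1 : ℝ) : Profile n m)).const_add xs
    have h2 : HasFDerivAt (f i) (fderiv ℝ (f i) xs)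
        (xs + (0 : ℝ) • EuclideanSpace.single i (1 : ℝ)) := by
      simpa using hf.hasFDerivAt
    exact h2.comp_hasDerivAt 0 h1
  refine IsLocalMin.hasDerivAt_eq_zero (Eventually.of_forall fun a => ?_) hd
  simpa [← hline] using hxs i (xs i + a)

/-! ### The communication graph -/

section Graph

variable {V : Type*} [Fintype V]

open Classical in
/-- The quadratic form of the consensus dynamics of the estimates. -/
noncomputable def consensusForm (G : SimpleGraph V) (w : V → V → ℝ) : ℝ :=
  ∑ i, ∑ j, w i j * ((∑ k, G.adjMatrix ℝ i k * (w i j - w k j)) + G.adjMatrix ℝ i j * w i j)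

open Classical in
-- Symmetrisation of the Laplacian form of each column, using that the graph is undirected.
theorem consensusForm_eq (G : SimpleGraph V) (w : V → V → ℝ) :
    consensusForm G w = (∑ j, ∑ i, ∑ k, G.adjMatrix ℝ i k * (w i j - w k j) ^ 2) / 2
      + ∑ i, ∑ j, G.adjMatrix ℝ i j * w i j ^ 2 := by
  have hcol : ∀ u : V → ℝ, ∑ i, u i * ∑ k, G.adjMatrix ℝ i k * (u i - u k)
      = (∑ i, ∑ k, G.adjMatrix ℝ i k * (u i - u k) ^ 2) / 2 := by
    intro u
    have hswap : ∑ i, ∑ k, G.adjMatrix ℝ i k * (u i - u k) * u i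
        = ∑ i, ∑ k, G.adjMatrix ℝ i k * (u k - u i) * u k := by
      rw [Finset.sum_comm]
      refine Finset.sum_congr rfl fun i _ => Finset.sum_congr rfl fun k _ => ?_
      simp only [SimpleGraph.adjMatrix_apply, G.adj_comm]
    have h1 : ∑ i, ∑ k, G.adjMatrix ℝ i k * (u i - u k) ^ 2
        = ∑ i, ∑ k, G.adjMatrix ℝ i k * (u i - u k) * u i
          + ∑ i, ∑ k, G.adjMatrix ℝ i k * (u k - u i) * u k := by
      simp only [← Finset.sum_add_distrib]
      refine Finset.sum_congr rfl fun i _ => Finset.sum_congr rfl fun k _ => ?_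
      ring
    rw [h1, ← hswap, ← two_mul, mul_div_cancel_left₀ _ two_ne_zero]
    refine Finset.sum_congr rfl fun i _ => ?_
    rw [Finset.mul_sum]
    exact Finset.sum_congr rfl fun k _ => mul_comm _ _
  simp only [consensusForm, mul_add, Finset.sum_add_distrib]
  congr 1
  · rw [Finset.sum_comm, Finset.sum_div]
    exact Finset.sum_congr rfl fun j _ => hcol fun i => w i j
  · refine Finset.sum_congr rfl fun i _ => Finset.sum_congr rfl fun k _ => ?_
    ring

/-- If the form vanishes, each column `j` is constant along edges, hence constant by connectedness,
and is zero at the neighbours of `j`. A neighbour exists because there are at least two vertices. -/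
theorem consensusForm_pos [Nontrivial V] {G : SimpleGraph V} (hG : G.Connected) {w : V → V → ℝ}
    (hw : w ≠ 0) : 0 < consensusForm G w := by
  classical
  have hadj : ∀ i k, 0 ≤ G.adjMatrix ℝ i k := fun i k => by
    rw [SimpleGraph.adjMatrix_apply]; split_ifs <;> norm_num
  have hA : ∀ j i k, 0 ≤ G.adjMatrix ℝ i k * (w i j - w k j) ^ 2 :=
    fun j i k => mul_nonneg (hadj i k) (sq_nonneg _)
  have hB : ∀ i j, 0 ≤ G.adjMatrix ℝ i j * w i j ^ 2 :=
    fun i j => mul_nonneg (hadj i j) (sq_nonneg _)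
  have hA' : 0 ≤ ∑ j, ∑ i, ∑ k, G.adjMatrix ℝ i k * (w i j - w k j) ^ 2 :=
    Finset.sum_nonneg fun j _ => Finset.sum_nonneg fun i _ => Finset.sum_nonneg fun k _ => hA j i k
  have hB' : 0 ≤ ∑ i, ∑ j, G.adjMatrix ℝ i j * w i j ^ 2 :=
    Finset.sum_nonneg fun i _ => Finset.sum_nonneg fun j _ => hB i j
  have heq : consensusForm G w = (∑ j, ∑ i, ∑ k, G.adjMatrix ℝ i k * (w i j - w k j) ^ 2) / 2
      + ∑ i, ∑ j, G.adjMatrix ℝ i j * w i j ^ 2 := by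
    convert consensusForm_eq G w
  by_contra! hle
  have hA0 : ∑ j, ∑ i, ∑ k, G.adjMatrix ℝ i k * (w i j - w k j) ^ 2 = 0 := by linarith
  have hB0 : ∑ i, ∑ j, G.adjMatrix ℝ i j * w i j ^ 2 = 0 := by linarith
  have hedge : ∀ j i k, G.Adj i k → w i j = w k j := by
    intro j i k hik
    have h1 := (Finset.sum_eq_zero_iff_of_nonneg fun j _ =>
      Finset.sum_nonneg fun i _ => Finset.sum_nonneg fun k _ => hA j i k).1 hA0 j (Finset.mem_univ _)
    have h2 := (Finset.sum_eq_zero_iff_of_nonneg fun i _ =>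
      Finset.sum_nonneg fun k _ => hA j i k).1 h1 i (Finset.mem_univ _)
    have h3 := (Finset.sum_eq_zero_iff_of_nonneg fun k _ => hA j i k).1 h2 k (Finset.mem_univ _)
    simpa [SimpleGraph.adjMatrix_apply, hik, sub_eq_zero] using h3
  have hself : ∀ i j, G.Adj i j → w i j = 0 := by
    intro i j hij
    have h1 := (Finset.sum_eq_zero_iff_of_nonneg fun i _ =>
      Finset.sum_nonneg fun j _ => hB i j).1 hB0 i (Finset.mem_univ _)
    have h2 := (Finset.sum_eq_zero_iff_of_nonneg fun j _ => hB i j).1 h1 j (Finset.mem_univ _)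
    simpa [SimpleGraph.adjMatrix_apply, hij] using h2
  have hreach : ∀ j i k, G.Reachable i k → w i j = w k j := by
    rintro j i k ⟨p⟩
    induction p with
    | nil => rfl
    | cons hA _ h' => exact (hedge j _ _ hA).trans h'
  refine hw (funext fun i => funext fun j => ?_)
  obtain ⟨k, hk⟩ := hG.preconnected.exists_adj_of_nontrivial j
  rw [hreach j i k (hG.preconnected i k)]
  exact hself k j hk.symm

/-- The constant is the minimum on the unit sphere, which is compact; homogeneity of degree two
extends the bound. -/
theorem exists_le_consensusForm [Nontrivial V] {G : SimpleGraph V} (hG : G.Connected) :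
    ∃ c > 0, ∀ w : V → V → ℝ, c * ∑ i, ∑ j, w i j ^ 2 ≤ consensusForm G w := by
  classical
  let Q : EuclideanSpace ℝ (V × V) → ℝ := fun w => consensusForm G fun i j => w (i, j)
  have hQ : Continuous Q := by
    simp only [Q, consensusForm]
    fun_prop
  have hnorm : ∀ w : EuclideanSpace ℝ (V × V), ‖w‖ ^ 2 = ∑ i, ∑ j, w (i, j) ^ 2 := fun w => by
    rw [EuclideanSpace.real_norm_sq_eq, Fintype.sum_prod_type]
  have hpos : ∀ w, w ≠ 0 → 0 < Q w := fun w hw => consensusForm_pos hG fun h => hw <| by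
    ext p
    exact congr_fun (congr_fun h p.1) p.2
  have hhom : ∀ (r : ℝ) w, Q (r • w) = r ^ 2 * Q w := fun r w => by
    simp only [Q, consensusForm, Finset.mul_sum]
    refine Finset.sum_congr rfl fun i _ => Finset.sum_congr rfl fun j _ => ?_
    simp only [PiLp.smul_apply, smul_eq_mul, mul_add, Finset.mul_sum]
    congr 1
    · exact Finset.sum_congr rfl fun k _ => by ring
    · ring
  obtain ⟨i₀⟩ := (inferInstance : Nonempty V)
  obtain ⟨w₀, hw₀, hmin⟩ := (isCompact_sphere (0 : EuclideanSpace ℝ (V × V)) 1).exists_isMinOn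
    ⟨EuclideanSpace.single (i₀, i₀) 1, by simp⟩ hQ.continuousOn
  refine ⟨Q w₀, hpos w₀ fun h => by simp [h] at hw₀, fun w => ?_⟩
  let w' : EuclideanSpace ℝ (V × V) := WithLp.toLp 2 fun p => w p.1 p.2
  have h1 : ∑ i, ∑ j, w i j ^ 2 = ‖w'‖ ^ 2 := (hnorm w').symm
  have h2 : consensusForm G w = Q w' := rfl
  rw [h1, h2]
  by_cases hw : w' = 0
  · rw [hw]
    have := hhom 0 0
    simp only [zero_smul] at this
    rw [this]; simp
  · have hn : 0 < ‖w'‖ := norm_pos_iff.2 hw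
    have h3 := hmin (a := ‖w'‖⁻¹ • w') (by simp [norm_smul, hn.ne'])
    have h4 : Q w₀ ≤ (‖w'‖⁻¹) ^ 2 * Q w' := by rw [← hhom]; exact h3
    calc Q w₀ * ‖w'‖ ^ 2 ≤ (‖w'‖⁻¹) ^ 2 * Q w' * ‖w'‖ ^ 2 := by gcongr
      _ = Q w' := by field_simp

end Graph

end MixedOrderGame
noncomputable section

namespace MixedOrderGame

variable {n m : ℕ} {net : RBFNetwork n m}

/-! ### Rates of the composite signals -/

/-- The rate of change of `x̄`. -/
def Traj.xbarRate (τ : Traj net) (f : Player n m → Profile n m → ℝ) (K : Gains) (t : ℝ) :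
    Profile n m :=
  WithLp.toLp 2 (Sum.elim (fun j => -K.k₂ * grad f (Sum.inl j) (τ.y (Sum.inl j) t))
    (fun j => τ.v t j))

open Classical in
/-- The rate of change of the estimates of player `i`. -/
def Traj.estimateRate (τ : Traj net) (G : SimpleGraph (Player n m)) (K : Gains) (i : Player n m)
    (t : ℝ) : Profile n m :=
  WithLp.toLp 2 fun j => -K.k₃ * ((∑ k, G.adjMatrix ℝ i k * (τ.y i t j - τ.y k t j))
    + G.adjMatrix ℝ i j * (τ.y i t j - τ.xbar t j))

/-- The part of the rate of change of the signal of player `i` that is not due to the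
player's own dynamics. -/
def Traj.signalDrift (τ : Traj net) (f : Player n m → Profile n m → ℝ)
    (G : SimpleGraph (Player n m)) (K : Gains) : Player n m → ℝ → ℝ
  | Sum.inl i, t => K.k₂ * grad f (Sum.inl i) (τ.y (Sum.inl i) t)
  | Sum.inr i, t => K.k₂ * fderiv ℝ (grad f (Sum.inr i)) (τ.y (Sum.inr i) t)
      (τ.estimateRate G K (Sum.inr i) t)

/-- The rate of change of the signal of player `i`. -/
def Traj.signalRate (τ : Traj net) (f g : Player n m → Profile n m → ℝ)
    (d : Player n m → ℝ → ℝ) (G : SimpleGraph (Player n m)) (R : RobustParams) (K : Gains)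
    (i : Player n m) (t : ℝ) : ℝ :=
  controlInput f K R τ i t + g i (τ.x t) + d i t + τ.signalDrift f G K i t

/-- The gain with which player `i`'s control feeds back the signal. -/
def Gains.feedback (K : Gains) : Player n m → ℝ
  | Sum.inl _ => K.k₁
  | Sum.inr _ => K.k₄

/-- In terms of the signal both classes of players use the same feedback, so one estimate serves for
both. -/
theorem controlInput_eq (f : Player n m → Profile n m → ℝ) (K : Gains) (R : RobustParams)
    (τ : Traj net) (i : Player n m) (t : ℝ) :
    controlInput f K R τ i t = -K.feedback i * τ.signal f K i t
      - inner ℝ (τ.W i t) (net.S i (τ.y i t)) - robustTerm R (τ.signal f K i t) := by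
  rcases i with i | i
  · rfl
  · simp only [controlInput, Gains.feedback, Traj.signal]
    ring

section ClosedLoop

variable {f g : Player n m → Profile n m → ℝ} {d : Player n m → ℝ → ℝ}
  {G : SimpleGraph (Player n m)} {R : RobustParams} {K : Gains} {τ : Traj net}

theorem IsClosedLoop.solvesAE_xbar (h : IsClosedLoop f g d G R K τ) :
    SolvesAE τ.xbar (τ.xbarRate f K) := by
  refine .of_coords fun j => ?_
  rcases j with j | j
  · exact h.auxiliary j
  · exact h.second_action j

theorem IsClosedLoop.solvesAE_estimate (h : IsClosedLoop f g d G R K τ) (i : Player n m) :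
    SolvesAE (τ.y i) (τ.estimateRate G K i) :=
  .of_coords fun j => h.estimate i j

theorem IsClosedLoop.solvesAE_signal (h : IsClosedLoop f g d G R K τ)
    (hf : ∀ i, ContDiff ℝ 2 (f i)) {L : ℝ≥0} (hL : ∀ i, LipschitzWith L (grad f i))
    (i : Player n m) : SolvesAE (τ.signal f K i) (τ.signalRate f g d G R K i) := by
  rcases i with i | i
  · refine ((h.first_action i).sub (h.auxiliary i)).congr_rate fun t => ?_
    simp only [Traj.signalRate, Traj.signalDrift]
    ring
  · have h1 := ((h.solvesAE_estimate (Sum.inr i)).comp_lipschitz (hL (Sum.inr i))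
      ((contDiff_grad (hf (Sum.inr i))).differentiable (by norm_num))).const_smul K.k₂
    refine (h1.add (h.second_velocity i)).congr_rate fun t => ?_
    simp only [Traj.signalRate, Traj.signalDrift, smul_eq_mul]
    ring

/-! ### The Lyapunov function -/

/-- The Lyapunov function of the closed loop. -/
def Traj.lyapunov (τ : Traj net) (f : Player n m → Profile n m → ℝ) (K : Gains)
    (xs : Profile n m) (Ws : net.Weights) (t : ℝ) : ℝ :=
  (1 / 2 : ℝ) * (‖τ.xbar t - xs‖ ^ 2 + ∑ i, ‖τ.y i t - τ.xbar t‖ ^ 2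
    + ∑ i, τ.signal f K i t ^ 2 + K.β⁻¹ * ∑ i, ‖τ.W i t - Ws i‖ ^ 2)

/-- The derivative of the Lyapunov function along trajectories. -/
def Traj.lyapunovRate (τ : Traj net) (f g : Player n m → Profile n m → ℝ)
    (d : Player n m → ℝ → ℝ) (G : SimpleGraph (Player n m)) (R : RobustParams) (K : Gains)
    (xs : Profile n m) (Ws : net.Weights) (t : ℝ) : ℝ :=
  inner ℝ (τ.xbar t - xs) (τ.xbarRate f K t)
    + ∑ i, inner ℝ (τ.y i t - τ.xbar t) (τ.estimateRate G K i t - τ.xbarRate f K t)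
    + ∑ i, (τ.signal f K i t * τ.signalRate f g d G R K i t
      + K.β⁻¹ * inner ℝ (τ.W i t - Ws i)
        (adaptLaw K.β R.Wmax (τ.W i t) (net.S i (τ.y i t)) (τ.signal f K i t)))

theorem IsClosedLoop.solvesAE_lyapunov (h : IsClosedLoop f g d G R K τ)
    (hf : ∀ i, ContDiff ℝ 2 (f i)) {L : ℝ≥0} (hL : ∀ i, LipschitzWith L (grad f i))
    (xs : Profile n m) (Ws : net.Weights) :
    SolvesAE (τ.lyapunov f K xs Ws) (τ.lyapunovRate f g d G R K xs Ws) := by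
  have h1 := (h.solvesAE_xbar.sub (.const xs)).norm_sq
  have h2 := SolvesAE.sum Finset.univ fun i _ =>
    ((h.solvesAE_estimate i).sub h.solvesAE_xbar).norm_sq
  have h3 := SolvesAE.sum Finset.univ fun i _ => (h.solvesAE_signal hf hL i).sq
  have h4 := (SolvesAE.sum Finset.univ fun i _ =>
    ((h.weights i).sub (.const (Ws i))).norm_sq).const_smul K.β⁻¹
  refine ((((h1.add h2).add h3).add h4).const_smul (1 / 2 : ℝ)).congr_rate fun t => ?_
  simp only [Traj.lyapunovRate, sub_zero, smul_eq_mul, Finset.sum_add_distrib, ← Finset.mul_sum]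
  ring

/-! ### The error norms -/

/-- The norm of the consensus error `y - 1 ⊗ x̄`. -/
def Traj.consensusError (τ : Traj net) (t : ℝ) : ℝ := √(∑ i, ‖τ.y i t - τ.xbar t‖ ^ 2)

/-- The norm of the tracking error `x_f - z_f` of the first-order players. -/
def Traj.firstError (τ : Traj net) (t : ℝ) : ℝ := √(∑ i : Fin n, (τ.x t (Sum.inl i) - τ.z t i) ^ 2)

/-- The norm of the signals of the second-order players. -/
def Traj.secondError (τ : Traj net) (f : Player n m → Profile n m → ℝ) (K : Gains) (t : ℝ) : ℝ :=
  √(∑ i : Fin m, τ.signal f K (Sum.inr i) t ^ 2)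

theorem Traj.consensusError_sq (τ : Traj net) (t : ℝ) :
    τ.consensusError t ^ 2 = ∑ i, ‖τ.y i t - τ.xbar t‖ ^ 2 :=
  Real.sq_sqrt (by positivity)

theorem Traj.firstError_sq (τ : Traj net) (t : ℝ) :
    τ.firstError t ^ 2 = ∑ i : Fin n, (τ.x t (Sum.inl i) - τ.z t i) ^ 2 :=
  Real.sq_sqrt (by positivity)

theorem Traj.secondError_sq (τ : Traj net) (f : Player n m → Profile n m → ℝ) (K : Gains)
    (t : ℝ) : τ.secondError f K t ^ 2 = ∑ i : Fin m, τ.signal f K (Sum.inr i) t ^ 2 :=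
  Real.sq_sqrt (by positivity)

theorem Traj.sum_signal_sq (τ : Traj net) (f : Player n m → Profile n m → ℝ) (K : Gains)
    (t : ℝ) : ∑ i, τ.signal f K i t ^ 2 = τ.firstError t ^ 2 + τ.secondError f K t ^ 2 := by
  rw [firstError_sq, secondError_sq, Fintype.sum_sum_type]
  rfl

theorem Traj.norm_estimate_sub_le (τ : Traj net) (i : Player n m) (t : ℝ) :
    ‖τ.y i t - τ.xbar t‖ ≤ τ.consensusError t :=
  Real.le_sqrt_of_sq_le <| Finset.single_le_sum (f := fun i => ‖τ.y i t - τ.xbar t‖ ^ 2)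
    (fun _ _ => by positivity) (Finset.mem_univ i)

theorem Traj.abs_signal_inl_le (τ : Traj net) (f : Player n m → Profile n m → ℝ) (K : Gains)
    (i : Fin n) (t : ℝ) : |τ.signal f K (Sum.inl i) t| ≤ τ.firstError t :=
  Real.abs_le_sqrt <| Finset.single_le_sum
    (f := fun i : Fin n => (τ.x t (Sum.inl i) - τ.z t i) ^ 2)
    (fun _ _ => by positivity) (Finset.mem_univ i)

theorem Traj.abs_signal_inr_le (τ : Traj net) (f : Player n m → Profile n m → ℝ) (K : Gains)
    (i : Fin m) (t : ℝ) : |τ.signal f K (Sum.inr i) t| ≤ τ.secondError f K t :=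
  Real.abs_le_sqrt <| Finset.single_le_sum
    (f := fun i : Fin m => τ.signal f K (Sum.inr i) t ^ 2)
    (fun _ _ => by positivity) (Finset.mem_univ i)

theorem Traj.norm_sub_xbar (τ : Traj net) (t : ℝ) : ‖τ.x t - τ.xbar t‖ = τ.firstError t := by
  rw [EuclideanSpace.norm_eq, Traj.firstError, Fintype.sum_sum_type]
  simp [Traj.xbar]

theorem Traj.norm_sub_estimate_le (τ : Traj net) (i : Player n m) (t : ℝ) :
    ‖τ.x t - τ.y i t‖ ≤ τ.firstError t + τ.consensusError t := by
  rw [← τ.norm_sub_xbar, ← sub_sub_sub_cancel_right _ _ (τ.xbar t)]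
  exact (norm_sub_le _ _).trans (add_le_add_right (τ.norm_estimate_sub_le i t) _)

/-- The factor is not sharp; the gains absorb it. -/
theorem norm_le_of_abs_le {ι : Type*} [Fintype ι] (w : EuclideanSpace ℝ ι) {c : ℝ}
    (h : ∀ j, |w j| ≤ c) : ‖w‖ ≤ Fintype.card ι * c := by
  classical
  calc ‖w‖ = ‖∑ j, w j • EuclideanSpace.single j (1 : ℝ)‖ := by
        congr 1
        ext k
        simp [Finset.sum_apply, Pi.single_apply]
    _ ≤ ∑ j, ‖w j • EuclideanSpace.single j (1 : ℝ)‖ := norm_sum_le _ _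
    _ ≤ ∑ _j : ι, c := Finset.sum_le_sum fun j _ => by simpa [norm_smul] using h j
    _ = _ := by simp

/-! ### Bounds on the rates -/

section Bounds

variable {L : ℝ≥0} {xs : Profile n m}

theorem Traj.abs_grad_estimate_le (hL : ∀ i, LipschitzWith L (grad f i))
    (hxs : ∀ i, grad f i xs = 0) (i : Player n m) (t : ℝ) :
    |grad f i (τ.y i t)| ≤ L * (τ.consensusError t + ‖τ.xbar t - xs‖) := by
  have h1 := (hL i).dist_le_mul (τ.y i t) xs
  rw [hxs i, dist_zero_right, Real.norm_eq_abs, dist_eq_norm] at h1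
  refine h1.trans (mul_le_mul_of_nonneg_left ?_ L.2)
  rw [← sub_add_sub_cancel _ (τ.xbar t)]
  exact (norm_add_le _ _).trans (add_le_add_left (τ.norm_estimate_sub_le i t) _)

/-- `x̄` follows the gradient flow `-k₂ 𝒫(x̄)` up to the consensus error and, for second-order
players, the signal, since `v = s - k₂ ∇f(y)`. -/
theorem Traj.abs_xbarRate_add_le (hL : ∀ i, LipschitzWith L (grad f i)) (hk₂ : 0 ≤ K.k₂)
    (j : Player n m) (t : ℝ) : |τ.xbarRate f K t j + K.k₂ * grad f j (τ.xbar t)|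
      ≤ K.k₂ * (L * τ.consensusError t) + τ.secondError f K t := by
  have h0 : 0 ≤ τ.secondError f K t := Real.sqrt_nonneg _
  have h1 : |K.k₂ * (grad f j (τ.xbar t) - grad f j (τ.y j t))|
      ≤ K.k₂ * (L * τ.consensusError t) := by
    rw [abs_mul, abs_of_nonneg hk₂]
    gcongr
    have h2 := (hL j).dist_le_mul (τ.xbar t) (τ.y j t)
    rw [Real.dist_eq, dist_comm, dist_eq_norm] at h2
    exact h2.trans (mul_le_mul_of_nonneg_left (τ.norm_estimate_sub_le j t) L.2)
  rcases j with j | j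
  · have h3 : τ.xbarRate f K t (Sum.inl j) + K.k₂ * grad f (Sum.inl j) (τ.xbar t)
        = K.k₂ * (grad f (Sum.inl j) (τ.xbar t) - grad f (Sum.inl j) (τ.y (Sum.inl j) t)) := by
      simp only [xbarRate, Sum.elim_inl]
      ring
    rw [h3]
    linarith
  · have h3 : τ.xbarRate f K t (Sum.inr j) + K.k₂ * grad f (Sum.inr j) (τ.xbar t)
        = K.k₂ * (grad f (Sum.inr j) (τ.xbar t) - grad f (Sum.inr j) (τ.y (Sum.inr j) t))
          + τ.signal f K (Sum.inr j) t := by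
      simp only [xbarRate, Sum.elim_inr, signal]
      ring
    rw [h3]
    exact (abs_add_le _ _).trans (add_le_add h1 (τ.abs_signal_inr_le f K j t))

theorem Traj.abs_xbarRate_le (hL : ∀ i, LipschitzWith L (grad f i))
    (hxs : ∀ i, grad f i xs = 0) (hk₂ : 0 ≤ K.k₂) (j : Player n m) (t : ℝ) :
    |τ.xbarRate f K t j|
      ≤ K.k₂ * (L * (τ.consensusError t + ‖τ.xbar t - xs‖)) + τ.secondError f K t := by
  have h0 : 0 ≤ τ.secondError f K t := Real.sqrt_nonneg _
  have h1 : |K.k₂ * grad f j (τ.y j t)|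
      ≤ K.k₂ * (L * (τ.consensusError t + ‖τ.xbar t - xs‖)) := by
    rw [abs_mul, abs_of_nonneg hk₂]
    exact mul_le_mul_of_nonneg_left (abs_grad_estimate_le hL hxs j t) hk₂
  rcases j with j | j
  · simp only [xbarRate, Sum.elim_inl, neg_mul, abs_neg]
    linarith
  · have h3 : τ.xbarRate f K t (Sum.inr j) = τ.signal f K (Sum.inr j) t
        - K.k₂ * grad f (Sum.inr j) (τ.y (Sum.inr j) t) := by
      simp only [xbarRate, Sum.elim_inr, signal]
      ring
    rw [h3]
    linarith [abs_sub (τ.signal f K (Sum.inr j) t)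
      (K.k₂ * grad f (Sum.inr j) (τ.y (Sum.inr j) t)), τ.abs_signal_inr_le f K j t]

/-- The rate depends only on deviations from `x̄`, because `x̄` cancels in the differences of
estimates. -/
theorem Traj.norm_estimateRate_le (hk₃ : 0 ≤ K.k₃) (i : Player n m) (t : ℝ) :
    ‖τ.estimateRate G K i t‖ ≤ Fintype.card (Player n m) *
      (K.k₃ * ((2 * Fintype.card (Player n m) + 1) * τ.consensusError t)) := by
  classical
  have hadj : ∀ i k, |G.adjMatrix ℝ i k| ≤ 1 := fun i k => by
    rw [SimpleGraph.adjMatrix_apply]; split_ifs <;> norm_num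
  have hcoord : ∀ k j, |τ.y k t j - τ.xbar t j| ≤ τ.consensusError t := fun k j =>
    (PiLp.norm_apply_le (τ.y k t - τ.xbar t) j).trans (τ.norm_estimate_sub_le k t)
  refine norm_le_of_abs_le _ fun j => ?_
  have h1 : |∑ k, G.adjMatrix ℝ i k * (τ.y i t j - τ.y k t j)|
      ≤ Fintype.card (Player n m) * (2 * τ.consensusError t) := by
    refine (Finset.abs_sum_le_sum_abs _ _).trans ?_
    refine (Finset.sum_le_sum (g := fun _ => 2 * τ.consensusError t) fun k _ => ?_).trans
      (by simp)
    rw [abs_mul]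
    have h2 : |τ.y i t j - τ.y k t j| ≤ 2 * τ.consensusError t := by
      rw [← sub_sub_sub_cancel_right _ _ (τ.xbar t j)]
      linarith [abs_sub (τ.y i t j - τ.xbar t j) (τ.y k t j - τ.xbar t j), hcoord i j, hcoord k j]
    exact (mul_le_of_le_one_left (abs_nonneg _) (hadj i k)).trans h2
  have h3 : |G.adjMatrix ℝ i j * (τ.y i t j - τ.xbar t j)| ≤ τ.consensusError t := by
    rw [abs_mul]
    exact (mul_le_of_le_one_left (abs_nonneg _) (hadj i j)).trans (hcoord i j)
  have h4 : |τ.estimateRate G K i t j| = K.k₃ *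
      |(∑ k, G.adjMatrix ℝ i k * (τ.y i t j - τ.y k t j))
        + G.adjMatrix ℝ i j * (τ.y i t j - τ.xbar t j)| := by
    simp only [estimateRate, abs_mul, abs_neg, abs_of_nonneg hk₃]
  rw [h4]
  gcongr
  refine (abs_add_le _ _).trans ((add_le_add h1 h3).trans (le_of_eq ?_))
  ring

theorem Traj.sum_inner_estimateRate (τ : Traj net) (G : SimpleGraph (Player n m)) (K : Gains)
    (t : ℝ) : ∑ i, inner ℝ (τ.y i t - τ.xbar t) (τ.estimateRate G K i t)
      = -K.k₃ * consensusForm G fun i j => τ.y i t j - τ.xbar t j := by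
  simp only [consensusForm, Finset.mul_sum (a := -K.k₃), PiLp.inner_apply]
  refine Finset.sum_congr rfl fun i _ => Finset.sum_congr rfl fun j _ => ?_
  simp only [estimateRate, PiLp.sub_apply, sub_sub_sub_cancel_right]
  simp only [RCLike.inner_apply, conj_trivial]
  ring

end Bounds

end ClosedLoop

end MixedOrderGame

end
noncomputable section

namespace MixedOrderGame

variable {n m : ℕ} {net : RBFNetwork n m}

/-! ### The dissipation inequality -/

/-- Here `a = ŴᵀS`, `b = W*ᵀS`, and `p` is the weight term. Writing `gx - a` as `(gx - gy) + (gy -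
b) - (a - b)`, the last part is cancelled by `β⁻¹ p`, and `φ` compensates `gy - b + d`. -/
theorem signal_term_le {s k a b φ gx gy d q p β δ ε M Q : ℝ} (hβ : 0 < β)
    (hp : p ≤ β * (s * (a - b))) (hg : |gx - gy| ≤ M) (hq : |q| ≤ Q)
    (hδ : |gy - b| + |d| ≤ δ) (hφ : |s| * δ - s * φ ≤ ε) :
    s * (-k * s - a - φ + gx + d + q) + β⁻¹ * p ≤ -k * s ^ 2 + ε + |s| * (M + Q) := by
  have h1 : β⁻¹ * p ≤ s * (a - b) := by
    rw [inv_mul_le_iff₀ hβ]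
    exact hp
  have hs := abs_nonneg s
  have h2 : s * (gx - gy) ≤ |s| * M :=
    (le_abs_self _).trans (by rw [abs_mul]; gcongr)
  have h3 : s * q ≤ |s| * Q := (le_abs_self _).trans (by rw [abs_mul]; gcongr)
  have h4 : s * (gy - b + d) ≤ |s| * δ :=
    (le_abs_self _).trans (by rw [abs_mul]; gcongr; exact (abs_add_le _ _).trans hδ)
  linarith

section

variable {f g : Player n m → Profile n m → ℝ} {d : Player n m → ℝ → ℝ}
  {G : SimpleGraph (Player n m)} {R : RobustParams} {K : Gains} {τ : Traj net}
  {L H : ℝ≥0} {xs : Profile n m} {t : ℝ}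

/-- Strong monotonicity between `x̄` and `xs`, where the pseudo-gradient vanishes; Cauchy–Schwarz
handles the deviation from the gradient flow. -/
theorem Traj.inner_xbarRate_le (hL : ∀ i, LipschitzWith L (grad f i))
    (hxs : ∀ i, grad f i xs = 0) (hk₂ : 0 ≤ K.k₂) {μ : ℝ}
    (hmono : ∀ x z : Profile n m,
      μ * ‖x - z‖ ^ 2 ≤ inner ℝ (x - z) (pseudoGrad f x - pseudoGrad f z)) :
    inner ℝ (τ.xbar t - xs) (τ.xbarRate f K t) ≤ -(K.k₂ * μ) * ‖τ.xbar t - xs‖ ^ 2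
      + ‖τ.xbar t - xs‖ * (Fintype.card (Player n m) *
        (K.k₂ * (L * τ.consensusError t) + τ.secondError f K t)) := by
  have h0 : pseudoGrad f xs = 0 := by ext i; exact hxs i
  have h1 := hmono (τ.xbar t) xs
  rw [h0, sub_zero] at h1
  have h2 := (real_inner_le_norm (τ.xbar t - xs)
    (τ.xbarRate f K t + K.k₂ • pseudoGrad f (τ.xbar t))).trans
    (mul_le_mul_of_nonneg_left (norm_le_of_abs_le _ fun j =>
      abs_xbarRate_add_le (τ := τ) hL hk₂ j t) (norm_nonneg _))
  rw [inner_add_right, inner_smul_right] at h2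
  have h3 := mul_le_mul_of_nonneg_left h1 hk₂
  linarith

theorem Traj.sum_inner_estimate_le (hL : ∀ i, LipschitzWith L (grad f i))
    (hxs : ∀ i, grad f i xs = 0) (hk₂ : 0 ≤ K.k₂) (hk₃ : 0 ≤ K.k₃) {c : ℝ}
    (hc : ∀ w : Player n m → Player n m → ℝ, c * ∑ i, ∑ j, w i j ^ 2 ≤ consensusForm G w) :
    ∑ i, inner ℝ (τ.y i t - τ.xbar t) (τ.estimateRate G K i t - τ.xbarRate f K t)
      ≤ -(K.k₃ * c) * τ.consensusError t ^ 2 + Fintype.card (Player n m) *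
        (τ.consensusError t * (Fintype.card (Player n m) *
          (K.k₂ * (L * (τ.consensusError t + ‖τ.xbar t - xs‖)) + τ.secondError f K t))) := by
  have h1 := hc fun i j => τ.y i t j - τ.xbar t j
  have h2 : ∑ i, ∑ j, (τ.y i t j - τ.xbar t j) ^ 2 = τ.consensusError t ^ 2 := by
    rw [consensusError_sq]
    exact Finset.sum_congr rfl fun i _ => (EuclideanSpace.real_norm_sq_eq (τ.y i t - τ.xbar t)).symm
  rw [h2] at h1
  simp only [inner_sub_right, Finset.sum_sub_distrib]
  rw [sum_inner_estimateRate]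
  have h3 : -∑ i, inner ℝ (τ.y i t - τ.xbar t) (τ.xbarRate f K t) ≤
      Fintype.card (Player n m) * (τ.consensusError t * (Fintype.card (Player n m) *
          (K.k₂ * (L * (τ.consensusError t + ‖τ.xbar t - xs‖)) + τ.secondError f K t))) := by
    rw [← Finset.sum_neg_distrib]
    rw [← nsmul_eq_mul, ← Finset.card_univ]
    refine Finset.sum_le_card_nsmul _ _ _ fun i _ => ?_
    refine (neg_le_abs _).trans ((abs_real_inner_le_norm _ _).trans ?_)
    exact mul_le_mul (τ.norm_estimate_sub_le i t)
      (norm_le_of_abs_le _ fun j => abs_xbarRate_le hL hxs hk₂ j t) (norm_nonneg _)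
      (Real.sqrt_nonneg _)
  have h4 := mul_le_mul_of_nonneg_left h1 hk₃
  linarith

/-- The bound on `Traj.signalDrift`. -/
def Traj.driftBound (τ : Traj net) (K : Gains) (L : ℝ≥0) (xs : Profile n m) (t : ℝ) :
    Player n m → ℝ
  | Sum.inl _ => K.k₂ * (L * (τ.consensusError t + ‖τ.xbar t - xs‖))
  | Sum.inr _ => K.k₂ * (L * (Fintype.card (Player n m) *
      (K.k₃ * ((2 * Fintype.card (Player n m) + 1) * τ.consensusError t))))

theorem Traj.abs_signalDrift_le (hL : ∀ i, LipschitzWith L (grad f i))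
    (hxs : ∀ i, grad f i xs = 0) (hk₂ : 0 ≤ K.k₂) (hk₃ : 0 ≤ K.k₃) (i : Player n m) :
    |τ.signalDrift f G K i t| ≤ τ.driftBound K L xs t i := by
  rcases i with i | i
  · simp only [signalDrift, driftBound, abs_mul, abs_of_nonneg hk₂]
    exact mul_le_mul_of_nonneg_left (abs_grad_estimate_le hL hxs _ t) hk₂
  · simp only [signalDrift, driftBound, abs_mul, abs_of_nonneg hk₂]
    refine mul_le_mul_of_nonneg_left ?_ hk₂
    -- The derivative of an `L`-Lipschitz function has operator norm at most `L`.
    refine ((fderiv ℝ (grad f (Sum.inr i)) _).le_opNorm _).trans ?_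
    exact mul_le_mul (norm_fderiv_le_of_lipschitz ℝ (hL _)) (norm_estimateRate_le hk₃ _ t)
      (norm_nonneg _) L.2

theorem Traj.signal_mul_signalRate_le (hL : ∀ i, LipschitzWith L (grad f i))
    (hH : ∀ i, LipschitzWith H (g i)) (hxs : ∀ i, grad f i xs = 0) (hk₂ : 0 ≤ K.k₂)
    (hk₃ : 0 ≤ K.k₃) (hβ : 0 < K.β) (hδ : 0 < R.δ) (hε : 0 < R.ε)
    (hκ : R.κ = Real.exp (-(R.κ + 1))) {Ws : net.Weights} (i : Player n m)
    (hW : ‖τ.W i t‖ ^ 2 ≤ R.Wmax) (hWs : ‖Ws i‖ ^ 2 ≤ R.Wmax)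
    (herr : |net.approxError g Ws i (τ.y i t)| + |d i t| ≤ R.δ) :
    τ.signal f K i t * τ.signalRate f g d G R K i t
      + K.β⁻¹ * inner ℝ (τ.W i t - Ws i)
        (adaptLaw K.β R.Wmax (τ.W i t) (net.S i (τ.y i t)) (τ.signal f K i t))
      ≤ -K.feedback i * τ.signal f K i t ^ 2 + R.ε + |τ.signal f K i t| *
        (H * (τ.firstError t + τ.consensusError t) + τ.driftBound K L xs t i) := by
  have hp := inner_sub_adaptLaw_le (s := τ.signal f K i t) (S := net.S i (τ.y i t)) hβ.le hW hWs
  rw [inner_sub_left (τ.W i t) (Ws i) (net.S i (τ.y i t))] at hp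
  rw [signalRate, controlInput_eq]
  refine signal_term_le hβ hp ?_ (abs_signalDrift_le hL hxs hk₂ hk₃ i) herr
    (abs_mul_sub_robustTerm_le hδ hε hκ _)
  have := (hH i).dist_le_mul (τ.x t) (τ.y i t)
  rw [Real.dist_eq, dist_eq_norm] at this
  exact this.trans (mul_le_mul_of_nonneg_left (τ.norm_sub_estimate_le i t) H.2)

/-- Reduces the choice of gains to a quadratic form in four scalars: `E` (distance of `x̄` to `xs`),
`Y` (consensus), `A` and `B` (signals of the two classes). -/
theorem Traj.lyapunovRate_le (hL : ∀ i, LipschitzWith L (grad f i))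
    (hH : ∀ i, LipschitzWith H (g i)) (hxs : ∀ i, grad f i xs = 0) (hk₂ : 0 ≤ K.k₂)
    (hk₃ : 0 ≤ K.k₃) (hβ : 0 < K.β) (hδ : 0 < R.δ) (hε : 0 < R.ε)
    (hκ : R.κ = Real.exp (-(R.κ + 1))) {μ c : ℝ}
    (hmono : ∀ x z : Profile n m,
      μ * ‖x - z‖ ^ 2 ≤ inner ℝ (x - z) (pseudoGrad f x - pseudoGrad f z))
    (hc : ∀ w : Player n m → Player n m → ℝ, c * ∑ i, ∑ j, w i j ^ 2 ≤ consensusForm G w)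
    {Ws : net.Weights} (hW : ∀ i, ‖τ.W i t‖ ^ 2 ≤ R.Wmax) (hWs : ∀ i, ‖Ws i‖ ^ 2 ≤ R.Wmax)
    (herr : ∀ i, |net.approxError g Ws i (τ.y i t)| + |d i t| ≤ R.δ)
    {N E Y A B : ℝ} (hN : N = Fintype.card (Player n m)) (hE : E = ‖τ.xbar t - xs‖)
    (hY : Y = τ.consensusError t) (hA : A = τ.firstError t) (hB : B = τ.secondError f K t) :
    τ.lyapunovRate f g d G R K xs Ws t ≤
      (-(K.k₂ * μ) * E ^ 2 + E * (N * (K.k₂ * (L * Y) + B)))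
      + (-(K.k₃ * c) * Y ^ 2 + N * (Y * (N * (K.k₂ * (L * (Y + E)) + B))))
      + (-K.k₁ * A ^ 2 + N * (A * (H * (A + Y) + K.k₂ * (L * (Y + E)))))
      + (-K.k₄ * B ^ 2 + N * (B * (H * (A + Y)
        + K.k₂ * (L * (N * (K.k₃ * ((2 * N + 1) * Y)))))))
      + N * R.ε := by
  have hE0 : 0 ≤ E := hE ▸ norm_nonneg _
  have hY0 : 0 ≤ Y := hY ▸ Real.sqrt_nonneg _
  have hA0 : 0 ≤ A := hA ▸ Real.sqrt_nonneg _
  have hB0 : 0 ≤ B := hB ▸ Real.sqrt_nonneg _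
  have hNnm : N = n + m := by rw [hN]; simp
  have hN0 : 0 ≤ N := by rw [hNnm]; positivity
  have h1 := inner_xbarRate_le (τ := τ) (t := t) hL hxs hk₂ hmono
  have h2 := sum_inner_estimate_le (τ := τ) (t := t) hL hxs hk₂ hk₃ hc
  have h3 := Finset.sum_le_sum fun i (_ : i ∈ Finset.univ) =>
    signal_mul_signalRate_le (τ := τ) (G := G) hL hH hxs hk₂ hk₃ hβ hδ hε hκ i (hW i) (hWs i)
      (herr i)
  rw [Fintype.sum_sum_type (f := fun i => -K.feedback i * τ.signal f K i t ^ 2 + R.ε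
    + |τ.signal f K i t| * (H * (τ.firstError t + τ.consensusError t)
      + τ.driftBound K L xs t i))] at h3
  simp only [Finset.sum_add_distrib (s := (Finset.univ : Finset (Fin n))),
    Finset.sum_add_distrib (s := (Finset.univ : Finset (Fin m))), Gains.feedback, driftBound,
    ← Finset.mul_sum, ← Finset.sum_mul, Finset.sum_const, Finset.card_univ, Fintype.card_fin,
    nsmul_eq_mul, ← secondError_sq] at h3
  have hsq : ∑ i : Fin n, τ.signal f K (Sum.inl i) t ^ 2 = A ^ 2 := by
    rw [hA, firstError_sq]; rfl
  have habsA : ∑ i : Fin n, |τ.signal f K (Sum.inl i) t| ≤ N * A := by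
    refine (Finset.sum_le_card_nsmul _ _ A fun i _ =>
      hA ▸ τ.abs_signal_inl_le f K i t).trans ?_
    rw [Finset.card_univ, Fintype.card_fin, nsmul_eq_mul, hNnm]
    gcongr
    simp
  have habsB : ∑ i : Fin m, |τ.signal f K (Sum.inr i) t| ≤ N * B := by
    refine (Finset.sum_le_card_nsmul _ _ B fun i _ =>
      hB ▸ τ.abs_signal_inr_le f K i t).trans ?_
    rw [Finset.card_univ, Fintype.card_fin, nsmul_eq_mul, hNnm]
    gcongr
    simp
  rw [hsq] at h3
  rw [← hN, ← hE, ← hY, ← hB] at h1 h2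
  rw [← hN, ← hE, ← hY, ← hA, ← hB] at h3
  have h4 := mul_le_mul_of_nonneg_right habsA
    (show 0 ≤ H * (A + Y) + K.k₂ * (L * (Y + E)) by positivity)
  have h5 := mul_le_mul_of_nonneg_right habsB
    (show 0 ≤ H * (A + Y) + K.k₂ * (L * (N * (K.k₃ * ((2 * N + 1) * Y)))) by positivity)
  have h6 : N * R.ε = n * R.ε + m * R.ε := by rw [hNnm]; ring
  rw [lyapunovRate, h6]
  linarith

end

/-- Domination of the cross terms by the gains. -/
theorem dissipation_le {N L H E Y A B ρ p q k₁ k₂ k₃ k₄ : ℝ}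
    (hp : ρ + 3 ≤ p) (hq : ρ + (N * (k₂ * L) + N ^ 2 * (k₂ * L)) ^ 2 + N ^ 2 * (k₂ * L) + 2 ≤ q)
    (hk₁ : ρ + (N * (k₂ * L)) ^ 2 + N * H + (N * H + N * (k₂ * L)) ^ 2 + 1 ≤ k₁)
    (hk₄ : ρ + N ^ 2 + (N ^ 2 + N * H + N * (k₂ * L) * (N * (k₃ * (2 * N + 1)))) ^ 2
      + (N * H) ^ 2 ≤ k₄) :
    (-p * E ^ 2 + E * (N * (k₂ * (L * Y) + B)))
      + (-q * Y ^ 2 + N * (Y * (N * (k₂ * (L * (Y + E)) + B))))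
      + (-k₁ * A ^ 2 + N * (A * (H * (A + Y) + k₂ * (L * (Y + E)))))
      + (-k₄ * B ^ 2 + N * (B * (H * (A + Y)
        + k₂ * (L * (N * (k₃ * ((2 * N + 1) * Y)))))))
      ≤ -ρ * (E ^ 2 + Y ^ 2 + (A ^ 2 + B ^ 2)) := by
  -- The coefficient goes entirely onto `v`. With the order `E`, `Y`, `A`, `B`, each variable pays
  -- one unit per later variable, whence the constants 3, 2, 1, 0, and large coefficients never
  -- burden a gain fixed earlier.
  have young : ∀ a u v : ℝ, a * (u * v) ≤ u ^ 2 + a ^ 2 * v ^ 2 := fun a u v => by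
    nlinarith [sq_nonneg (u - a * v), sq_nonneg u, sq_nonneg (a * v)]
  have y1 := young (N * (k₂ * L) + N ^ 2 * (k₂ * L)) E Y
  have y2 := young N E B
  have y3 := young (N * (k₂ * L)) E A
  have y4 := young (N ^ 2 + N * H + N * (k₂ * L) * (N * (k₃ * (2 * N + 1)))) Y B
  have y5 := young (N * H + N * (k₂ * L)) Y A
  have y6 := young (N * H) A B
  have e1 := mul_le_mul_of_nonneg_right hp (sq_nonneg E)
  have e2 := mul_le_mul_of_nonneg_right hq (sq_nonneg Y)
  have e3 := mul_le_mul_of_nonneg_right hk₁ (sq_nonneg A)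
  have e4 := mul_le_mul_of_nonneg_right hk₄ (sq_nonneg B)
  linarith

end MixedOrderGame

end
noncomputable section

namespace MixedOrderGame

variable {n m : ℕ} {net : RBFNetwork n m}

/-! ### Bounds on the Lyapunov function -/

section

variable {f g : Player n m → Profile n m → ℝ} {d : Player n m → ℝ → ℝ}
  {G : SimpleGraph (Player n m)} {R : RobustParams} {K : Gains} {τ : Traj net}
  {L H : ℝ≥0} {xs : Profile n m} {Ws : net.Weights}

theorem sum_norm_sub_sq_le {Wmax : ℝ} {t : ℝ} (hW : ∀ i, ‖τ.W i t‖ ^ 2 ≤ Wmax)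
    (hWs : ∀ i, ‖Ws i‖ ^ 2 ≤ Wmax) :
    ∑ i, ‖τ.W i t - Ws i‖ ^ 2 ≤ Fintype.card (Player n m) * (4 * Wmax) := by
  rw [← nsmul_eq_mul, ← Finset.card_univ]
  refine Finset.sum_le_card_nsmul _ _ _ fun i _ => ?_
  have h1 : ‖τ.W i t - Ws i‖ ^ 2 ≤ (‖τ.W i t‖ + ‖Ws i‖) ^ 2 := by
    gcongr
    exact norm_sub_le _ _
  nlinarith [sq_nonneg (‖τ.W i t‖ - ‖Ws i‖), hW i, hWs i]

theorem Traj.lyapunov_eq (τ : Traj net) (f : Player n m → Profile n m → ℝ) (K : Gains)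
    (xs : Profile n m) (Ws : net.Weights) (t : ℝ) :
    τ.lyapunov f K xs Ws t = (1 / 2 : ℝ) * (‖τ.xbar t - xs‖ ^ 2 + τ.consensusError t ^ 2
      + (τ.firstError t ^ 2 + τ.secondError f K t ^ 2)
      + K.β⁻¹ * ∑ i, ‖τ.W i t - Ws i‖ ^ 2) := by
  rw [lyapunov, ← sum_signal_sq, ← consensusError_sq]

theorem Traj.norm_sub_sq_le_lyapunov (hβ : 0 < K.β) (t : ℝ) :
    ‖τ.x t - xs‖ ^ 2 ≤ 4 * τ.lyapunov f K xs Ws t := by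
  have h1 : ‖τ.x t - xs‖ ≤ τ.firstError t + ‖τ.xbar t - xs‖ := by
    rw [← τ.norm_sub_xbar, ← sub_add_sub_cancel _ (τ.xbar t)]
    exact norm_add_le _ _
  have h2 : ‖τ.x t - xs‖ ^ 2 ≤ (τ.firstError t + ‖τ.xbar t - xs‖) ^ 2 := by gcongr
  have h3 : 0 ≤ K.β⁻¹ * ∑ i, ‖τ.W i t - Ws i‖ ^ 2 := by positivity
  rw [lyapunov_eq]
  nlinarith [sq_nonneg (τ.firstError t - ‖τ.xbar t - xs‖), sq_nonneg (τ.consensusError t),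
    sq_nonneg (τ.secondError f K t)]

/-- The bound does not involve the trajectory or the networks, which makes the settling time
uniform. Initial velocities enter through the second-order signals. -/
theorem Traj.lyapunov_zero_le (hL : ∀ i, LipschitzWith L (grad f i))
    (hxs : ∀ i, grad f i xs = 0) (hk₂ : 0 ≤ K.k₂) (hβ : 0 < K.β) {Λ : ℝ}
    (h : τ.initialErrorNorm xs + τ.initialWeightError Ws ≤ Λ) :
    τ.lyapunov f K xs Ws 0 ≤ (1 / 2 : ℝ) * (Λ ^ 2 + Λ ^ 2 + (Λ ^ 2
      + Fintype.card (Player n m) * (K.k₂ * (L * (Λ + Λ)) + Λ) ^ 2) + K.β⁻¹ * Λ) := by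
  have hw0 : 0 ≤ τ.initialWeightError Ws := by unfold initialWeightError; positivity
  have he0 : 0 ≤ τ.initialErrorNorm xs := Real.sqrt_nonneg _
  have hΛ : 0 ≤ Λ := by linarith
  have hsq : ‖τ.xbar 0 - xs‖ ^ 2 + ‖τ.v 0‖ ^ 2 + τ.consensusError 0 ^ 2 + τ.firstError 0 ^ 2
      ≤ Λ ^ 2 := by
    have h1 : τ.initialErrorNorm xs ≤ Λ := by linarith
    rw [initialErrorNorm, Real.sqrt_le_left hΛ] at h1
    rwa [consensusError_sq, firstError_sq]
  have hE2 := sq_nonneg ‖τ.xbar 0 - xs‖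
  have hv2 := sq_nonneg ‖τ.v 0‖
  have hY2 := sq_nonneg (τ.consensusError 0)
  have hA2 := sq_nonneg (τ.firstError 0)
  have hE : ‖τ.xbar 0 - xs‖ ≤ Λ := (abs_le_of_sq_le_sq' (by linarith) hΛ).2
  have hv : ‖τ.v 0‖ ≤ Λ := (abs_le_of_sq_le_sq' (by linarith) hΛ).2
  have hY : τ.consensusError 0 ≤ Λ := (abs_le_of_sq_le_sq' (by linarith) hΛ).2
  have hB : τ.secondError f K 0 ^ 2
      ≤ Fintype.card (Player n m) * (K.k₂ * (L * (Λ + Λ)) + Λ) ^ 2 := by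
    rw [secondError_sq]
    have h1 : ∀ i : Fin m, τ.signal f K (Sum.inr i) 0 ^ 2 ≤ (K.k₂ * (L * (Λ + Λ)) + Λ) ^ 2 := by
      intro i
      refine sq_le_sq' ?_ ?_ <;>
      · have h2 : |K.k₂ * grad f (Sum.inr i) (τ.y (Sum.inr i) 0)| ≤ K.k₂ * (L * (Λ + Λ)) := by
          rw [abs_mul, abs_of_nonneg hk₂]
          refine mul_le_mul_of_nonneg_left ((abs_grad_estimate_le hL hxs _ 0).trans ?_) hk₂
          exact mul_le_mul_of_nonneg_left (add_le_add hY hE) L.2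
        have h3 : |τ.v 0 i| ≤ Λ := (PiLp.norm_apply_le (τ.v 0) i).trans hv
        have := abs_le.1 h2
        have := abs_le.1 h3
        simp only [signal]
        linarith
    refine (Finset.sum_le_card_nsmul _ _ _ fun i _ => h1 i).trans ?_
    rw [nsmul_eq_mul, Finset.card_univ]
    gcongr
    simp
  have hw : K.β⁻¹ * ∑ i, ‖τ.W i 0 - Ws i‖ ^ 2 ≤ K.β⁻¹ * Λ := by
    refine mul_le_mul_of_nonneg_left ?_ (by positivity)
    have : τ.initialWeightError Ws ≤ Λ := by linarith
    exact this
  rw [lyapunov_eq]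
  linarith

end

end MixedOrderGame

end

/-! ### Choice of the gains and conclusion -/

open MixedOrderGame in
theorem theorem1 {n m : ℕ} (hn : 1 ≤ n) (hm : 1 ≤ m)
    (f g : Player n m → Profile n m → ℝ) (d : Player n m → ℝ → ℝ)
    (G : SimpleGraph (Player n m)) (xs : Profile n m) (hxs : IsNashEquilibrium f xs)
    -- costs are C², with globally Lipschitz partial gradients
    (hf : ∀ i, ContDiff ℝ 2 (f i))
    (l : Player n m → ℝ≥0) (hl : ∀ i, LipschitzWith (l i) (grad f i))
    -- the communication graph is undirected and connected
    (hG : G.Connected)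
    -- strong monotonicity of the pseudo-gradient
    (μ : ℝ) (hμ : 0 < μ)
    (hmono : ∀ x z : Profile n m,
      μ * ‖x - z‖ ^ 2 ≤ inner ℝ (x - z) (pseudoGrad f x - pseudoGrad f z))
    -- bounded second derivatives for the second-order players
    (hbd : ∀ (i : Fin m) (j : Player n m), ∃ C : ℝ, ∀ x : Profile n m,
      |partialDeriv j (partialDeriv (Sum.inr i) (f (Sum.inr i))) x| ≤ C)
    -- Lipschitz unknown dynamics and bounded disturbances
    (η : Player n m → ℝ≥0) (hg : ∀ i, LipschitzWith (η i) (g i))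
    (hd : ∀ i, ∃ D : ℝ, ∀ t : ℝ, 0 ≤ t → |d i t| ≤ D)
    -- the fixed parameters of the controller
    (δ ε Wmax κ : ℝ) (hδ : 0 < δ) (hε : 0 < ε) (hWmax : 0 < Wmax)
    (hκ : κ = Real.exp (-(κ + 1)))
    (Λ Ξ : ℝ) (hΛ : 0 < Λ) (hΞ : 0 < Ξ) :
    ∃ βs > 0, ∃ k₂s > 0, ∃ k₁s k₃s : ℝ → ℝ, ∃ k₄s : ℝ → ℝ → ℝ,
      (∀ k₂ > k₂s, 0 < k₁s k₂ ∧ 0 < k₃s k₂ ∧ ∀ k₃ > k₃s k₂, 0 < k₄s k₂ k₃) ∧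
      ∀ β > βs, ∀ k₂ > k₂s, ∀ k₁ > k₁s k₂, ∀ k₃ > k₃s k₂, ∀ k₄ > k₄s k₂ k₃,
        ∃ T : ℝ, 0 ≤ T ∧
          ∀ (net : RBFNetwork n m) (Ws : net.Weights) (τ : Traj net),
            (∀ i, ‖Ws i‖ ^ 2 ≤ Wmax) →
            IsClosedLoop f g d G ⟨δ, ε, Wmax, κ⟩ ⟨k₁, k₂, k₃, k₄, β⟩ τ →
            (∀ i, ∀ t : ℝ, 0 ≤ t →
              |net.approxError g Ws i (τ.y i t)| + |d i t| ≤ δ) →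
            τ.initialErrorNorm xs + τ.initialWeightError Ws ≤ Λ →
            ∀ t : ℝ, T < t → ‖τ.x t - xs‖ ≤ Ξ := by
  
  classical
  have : Nontrivial (Player n m) := ⟨Sum.inl ⟨0, hn⟩, Sum.inr ⟨0, hm⟩, by simp⟩
  have hgrad : ∀ i, grad f i xs = 0 := fun i =>
    hxs.grad_eq_zero ((hf i).differentiable (by norm_num) xs)
  obtain ⟨c, hc, hcons⟩ := exists_le_consensusForm hG
  obtain ⟨L, hL⟩ : ∃ L : ℝ≥0, ∀ i, LipschitzWith L (grad f i) :=
    ⟨∑ i, l i, fun i => (hl i).weaken (Finset.single_le_sum_of_canonicallyOrdered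
      (Finset.mem_univ i))⟩
  obtain ⟨H, hH⟩ : ∃ H : ℝ≥0, ∀ i, LipschitzWith H (g i) :=
    ⟨∑ i, η i, fun i => (hg i).weaken (Finset.single_le_sum_of_canonicallyOrdered
      (Finset.mem_univ i))⟩
  obtain ⟨N, hN⟩ : ∃ N : ℝ, N = Fintype.card (Player n m) := ⟨_, rfl⟩
  have hN0 : 0 < N := by
    rw [hN]
    exact_mod_cast Fintype.card_pos
  -- Chosen so that the residual `N ε / (2ρ)` of the robust terms is exactly `Ξ² / 12`.
  obtain ⟨ρ, hρ⟩ : ∃ ρ : ℝ, ρ = 6 * N * ε / Ξ ^ 2 := ⟨_, rfl⟩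
  have hρ0 : 0 < ρ := by rw [hρ]; positivity
  -- The first threshold makes the weight residual `2 N Wmax / β` at most `Ξ² / 12`; the others are
  -- the hypotheses of `dissipation_le` with `p = k₂ μ` and `q = k₃ c`.
  refine ⟨24 * N * Wmax / Ξ ^ 2, by positivity, (ρ + 3) / μ, by positivity,
    fun k₂ => ρ + (N * (k₂ * L)) ^ 2 + N * H + (N * H + N * (k₂ * L)) ^ 2 + 1,
    fun k₂ => (ρ + (N * (k₂ * L) + N ^ 2 * (k₂ * L)) ^ 2 + N ^ 2 * (k₂ * L) + 2) / c,
    fun k₂ k₃ => ρ + N ^ 2 + (N ^ 2 + N * H + N * (k₂ * L) * (N * (k₃ * (2 * N + 1)))) ^ 2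
      + (N * H) ^ 2, fun k₂ hk₂ => ?_, fun β hβ k₂ hk₂ k₁ hk₁ k₃ hk₃ k₄ hk₄ => ?_⟩
  · have hk₂0 : 0 < k₂ := lt_trans (by positivity) hk₂
    exact ⟨by positivity, by positivity, fun k₃ _ => by positivity⟩
  have hk₂0 : 0 < k₂ := lt_trans (by positivity) hk₂
  have hk₃0 : 0 < k₃ := lt_trans (by positivity) hk₃
  have hβ0 : 0 < β := lt_trans (by positivity) hβ
  have hp : ρ + 3 ≤ k₂ * μ := ((div_lt_iff₀ hμ).1 hk₂).le
  have hq := ((div_lt_iff₀ hc).1 hk₃).le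
  obtain ⟨V₀, hV₀⟩ : ∃ V₀ : ℝ, V₀ = (1 / 2 : ℝ) * (Λ ^ 2 + Λ ^ 2 + (Λ ^ 2
      + N * (k₂ * (L * (Λ + Λ)) + Λ) ^ 2) + β⁻¹ * Λ) := ⟨_, rfl⟩
  have hV₀0 : 0 < V₀ := by rw [hV₀]; positivity
  have hlim : Tendsto (fun t : ℝ => Real.exp (-(2 * ρ) * t) * V₀) atTop (𝓝 0) := by
    have h1 : Tendsto (fun t : ℝ => -(2 * ρ) * t) atTop atBot :=
      tendsto_id.const_mul_atTop_of_neg (by linarith)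
    simpa using (Real.tendsto_exp_atBot.comp h1).mul_const V₀
  obtain ⟨T, hT⟩ := eventually_atTop.1
    (hlim.eventually (gt_mem_nhds (show (0 : ℝ) < Ξ ^ 2 / 12 by positivity)))
  refine ⟨max T 0, le_max_right _ _, fun net Ws τ hWs hcl herr hinit t ht => ?_⟩
  have ht0 : 0 ≤ t := (le_max_right T 0).trans ht.le
  have hW : ∀ i, ∀ s : ℝ, 0 ≤ s → ‖τ.W i s‖ ^ 2 ≤ Wmax := fun i s hs =>
    norm_sq_le_of_adaptLaw hWmax (hcl.weights i) (hcl.weights_init i) hs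
  set K : Gains := ⟨k₁, k₂, k₃, k₄, β⟩ with hK
  -- The missing decay of the weights is added and subtracted: `ρ β⁻¹ Σ ‖W̃ᵢ‖² ≤ 4 ρ N Wmax β⁻¹`
  -- goes into the constant.
  have hdecay := (hcl.solvesAE_lyapunov hf hL xs Ws).le_exp (r := 2 * ρ)
    (c := 4 * ρ * N * Wmax * β⁻¹ + N * ε) (by positivity)
    (Eventually.of_forall fun s hs => by
      have h1 := Traj.lyapunovRate_le (K := K) (G := G) (τ := τ) (d := d) (t := s)
        (R := ⟨δ, ε, Wmax, κ⟩) (Ws := Ws) hL hH hgrad hk₂0.le hk₃0.le hβ0 hδ hε hκ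
        hmono hcons (fun i => hW i s hs.le) hWs (fun i => herr i s hs.le) hN rfl rfl rfl rfl
      have h2 := dissipation_le (E := ‖τ.xbar s - xs‖) (Y := τ.consensusError s)
        (A := τ.firstError s) (B := τ.secondError f K s) hp hq hk₁.le hk₄.le
      have h3 := mul_le_mul_of_nonneg_left
        (sum_norm_sub_sq_le (fun i => hW i s hs.le) hWs) (inv_pos.2 hβ0).le
      rw [← hN] at h3
      have h4 := mul_le_mul_of_nonneg_left h3 hρ0.le
      rw [Traj.lyapunov_eq]
      simp only [hK] at h1 h2 ⊢
      linarith) ht0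
  have hV0 : τ.lyapunov f K xs Ws 0 ≤ V₀ := by
    have := Traj.lyapunov_zero_le (K := K) hL hgrad hk₂0.le hβ0 hinit
    rwa [← hN, ← hV₀] at this
  have hexp := hT t ((le_max_left T 0).trans ht.le)
  have hres : (4 * ρ * N * Wmax * β⁻¹ + N * ε) / (2 * ρ) ≤ Ξ ^ 2 / 12 + Ξ ^ 2 / 12 := by
    have h1 : 2 * N * Wmax * β⁻¹ ≤ Ξ ^ 2 / 12 := by
      rw [gt_iff_lt, div_lt_iff₀ (by positivity)] at hβ
      rw [← div_eq_mul_inv, div_le_iff₀ hβ0]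
      linarith
    have h2 : N * ε / (2 * ρ) = Ξ ^ 2 / 12 := by
      rw [hρ]
      field_simp
      norm_num
    have h3 : (4 * ρ * N * Wmax * β⁻¹ + N * ε) / (2 * ρ)
        = 2 * N * Wmax * β⁻¹ + N * ε / (2 * ρ) := by
      field_simp
      ring
    rw [h3, h2]
    linarith
  have hbound : Real.exp (-(2 * ρ) * t) * (τ.lyapunov f K xs Ws 0
      - (4 * ρ * N * Wmax * β⁻¹ + N * ε) / (2 * ρ)) ≤ Real.exp (-(2 * ρ) * t) * V₀ := by
    have : 0 ≤ (4 * ρ * N * Wmax * β⁻¹ + N * ε) / (2 * ρ) := by positivity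
    gcongr
    linarith
  -- The transient and the two residuals contribute at most `Ξ² / 12` each, so `4 V ≤ Ξ²`.
  have hfin := Traj.norm_sub_sq_le_lyapunov (τ := τ) (f := f) (K := K) (xs := xs) (Ws := Ws) hβ0 t
  refine (abs_le_of_sq_le_sq' ?_ hΞ.le).2
  linarith
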